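/- **Setting.** Let $(A,\mathfrak m)$ be a Noetherian Cohen–Macaulay local ring of dimension $d\ge 1$ and of characteristic $p>0$, containing a field $k$ with $k\cong A/\mathfrak m$. Let $\mathcal F=\{I_n\}_{n\ge 0}$ be a filtration of ideals of $A$ such that * either $I_n=\mathfrak m^n$ for all $n$, * or $A$ is analytically unramified (its $\mathfrak m$-adic completion is reduced) and there is an $\mathfrak m$-primary ideal $I$ such that $\mathcal F$ is $I$-admissible (i.e. it is decreasing, $I^n\subseteq I_n$ and $I_mI_n\subseteq I_{m+n}$ for all $m,n$, and $I_{n+1}=I\,I_n$ for $n\gg 0$), $I_1=\overline{I}$, and $I_n=\overline{I^n}$ for all $n\gg 0$, where $\overline{J}$ denotes the integral closure of an ideal $J$. For a finitely generated $A$-module $L$ let $$e^T(L)=\lim_{n\to\infty}\frac{(d-1)!}{n^{d-1}}\,\ell\bigl(\operatorname{Tor}^A_1(L,A/I_{n+1})\bigr).$$ Let $M,N$ be maximal Cohen–Macaulay $A$-modules. For $\alpha\in\operatorname{Ext}^1_A(M,N)$ represented by $0\to N\to E\to M\to 0$ put $e^T(\alpha)=e^T(M)+e^T(N)-e^T(E)$.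 Call $\alpha$ $T$-split if $e^T(\alpha)=0$, and let $T(M,N)\subseteq \operatorname{Ext}^1_A(M,N)$ be the set of $T$-split classes. **Theorem.** Assume $\operatorname{Ext}^1_A(M,N)\neq T(M,N)$. Then: 1. the limits $e^T(M)$, $e^T(N)$ and $e^T(E)$ (for every extension $E$ as above) exist and are non-negative integers, and $e^T(\alpha)$ is a non-negative integer for every $\alpha\in\operatorname{Ext}^1_A(M,N)$; 2. $e^T(\alpha+\tau)=e^T(\alpha)$ for all $\alpha\in\operatorname{Ext}^1_A(M,N)$ and $\tau\in T(M,N)$; 3. $e^T(c\,\alpha)=e^T(\alpha)$ for all $\alpha\in\operatorname{Ext}^1_A(M,N)$ and $c\in k\setminus\{0\}$; 4. $T(M,N)$ is an $A$-submodule of $\operatorname{Ext}^1_A(M,N)$, and there is a map $$\overline{e}\colon \mathbb P\bigl(\operatorname{Ext}^1_A(M,N)/T(M,N)\bigr)\longrightarrow \mathbb N\setminus\{0\}$$ on the projective space of this $k$-vector space such that $e^T(\alpha)=\overline{e}([\alpha])$ for every $\alpha\notin T(M,N)$, where $[\alpha]$ is the point given by the class of $\alpha$. -/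

import Mathlib

open CategoryTheory CategoryTheory.Abelian CategoryTheory.Limits Filter Topology IsLocalRing

universe u v

noncomputable section

namespace TSplit

/-! ### Cohen-Macaulay modules, integral closure of ideals, filtrations -/

/-- Maximal Cohen-Macaulay modules over a Noetherian local ring `A`: finitely generated modules `M`
having an `M`-regular sequence in the maximal ideal of length `dim A`, that is `depth M ≥ dim A`
(equivalently `depth M = dim A` when `M ≠ 0`; the zero module, of depth `∞`, is allowed). -/
def IsMCM (A : Type u) [CommRing A] [IsLocalRing A] (M : Type v) [AddCommGroup M] [Module A M] :
    Prop :=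
  Module.Finite A M ∧ ∃ rs : List A, (∀ r ∈ rs, r ∈ maximalIdeal A) ∧
    RingTheory.Sequence.IsWeaklyRegular M rs ∧ (rs.length : WithBot ℕ∞) = ringKrullDim A

/-- A Noetherian local ring `A` is Cohen-Macaulay if `depth A = dim A`. -/
def IsCohenMacaulay (A : Type u) [CommRing A] [IsLocalRing A] : Prop :=
  IsNoetherianRing A ∧ IsMCM A A

/-- A Noetherian local ring is analytically unramified if its completion is reduced. -/
def IsAnalyticallyUnramified (A : Type u) [CommRing A] [IsLocalRing A] : Prop :=
  IsReduced (AdicCompletion (maximalIdeal A) A)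

/-- `x` is integral over the ideal `I`: there are `n ≥ 1` and `a i ∈ I ^ i` (`1 ≤ i ≤ n`) with
`x ^ n + a 1 * x ^ (n - 1) + ⋯ + a n = 0`. -/
def IsIntegralOverIdeal {A : Type u} [CommRing A] (I : Ideal A) (x : A) : Prop :=
  ∃ (n : ℕ) (a : ℕ → A), 1 ≤ n ∧ (∀ i ∈ Finset.Icc 1 n, a i ∈ I ^ i) ∧
    x ^ n + ∑ i ∈ Finset.Icc 1 n, a i * x ^ (n - i) = 0

/-- The ideal `J` is the integral closure of the ideal `I`. -/
def IsIntegralClosureOf {A : Type u} [CommRing A] (J I : Ideal A) : Prop :=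
  ∀ x : A, x ∈ J ↔ IsIntegralOverIdeal I x

/-- `I`-admissible filtrations `F 0 ⊇ F 1 ⊇ ⋯` (extended by `F n = A` for `n < 0`). -/
structure IsAdmissible {A : Type u} [CommRing A] (I : Ideal A) (F : ℕ → Ideal A) : Prop where
  antitone : Antitone F
  pow_le : ∀ n, I ^ n ≤ F n
  mul_le : ∀ m n, F m * F n ≤ F (m + n)
  stable : ∃ n₀, ∀ n ≥ n₀, F (n + 1) = I * F n

/-- `F` is an `I`-admissible filtration with `F 1` the integral closure of `I` and `F n` the
integral closure of `I ^ n` for all large `n`, where `I` is an `𝔪`-primary ideal. -/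
def IsIntegralClosureFiltration {A : Type u} [CommRing A] [IsLocalRing A] (F : ℕ → Ideal A) :
    Prop :=
  ∃ I : Ideal A, I.radical = maximalIdeal A ∧ IsAdmissible I F ∧ IsIntegralClosureOf (F 1) I ∧
    ∃ n₀, ∀ n ≥ n₀, IsIntegralClosureOf (F n) (I ^ n)

/-! ### The middle term of a class in `Ext¹` -/

section

variable {A : Type u} [CommRing A]

/-- `E` is the middle term of a short exact sequence `0 → N → E → M → 0` with class `α`. -/
def IsMiddle {M N : ModuleCat.{u} A} (α : Ext M N 1) (E : ModuleCat.{u} A) : Prop :=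
  ∃ (i : N ⟶ E) (q : E ⟶ M) (w : i ≫ q = 0) (h : (ShortComplex.mk i q w).ShortExact),
    h.extClass = α

/-- Every class in `Ext¹(M, N)` is the class of a short exact sequence. -/
theorem exists_isMiddle {M N : ModuleCat.{u} A} (α : Ext M N 1) : ∃ E, IsMiddle α E := by
  let S := ShortComplex.mk _ _ (kernel.condition (Projective.π M))
  have hS : S.ShortExact :=
    { exact := ShortComplex.exact_of_f_is_kernel _ (kernelIsKernel S.g) }
  obtain ⟨x, hx⟩ := Ext.contravariant_sequence_exact₃ hS N α
    (Ext.eq_zero_of_projective _) (n₀ := 0) rfl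
  obtain ⟨u, rfl⟩ := (Ext.mk₀_bijective _ _).2 x
  let q : pushout S.f u ⟶ M := pushout.desc S.g 0 (by simp [S.zero])
  have w : pushout.inr S.f u ≫ q = 0 := pushout.inr_desc _ _ _
  have hq : Epi q := by
    have : Epi (pushout.inl S.f u ≫ q) := by
      rw [pushout.inl_desc]; exact hS.epi_g
    exact epi_of_epi (pushout.inl S.f u) q
  have hm : Mono S.f := hS.mono_f
  have hT : (ShortComplex.mk _ _ w).ShortExact :=
    { exact := by
        apply ShortComplex.exact_of_g_is_cokernel
        refine CokernelCofork.IsColimit.ofπ' _ _ (fun {B} k hk => ?_)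
        have hk' : S.f ≫ pushout.inl S.f u ≫ k = 0 := by
          rw [pushout.condition_assoc, hk, comp_zero]
        refine ⟨hS.exact.desc (pushout.inl S.f u ≫ k) hk', ?_⟩
        apply pushout.hom_ext
        · rw [pushout.inl_desc_assoc]; exact hS.exact.g_desc _ _
        · rw [pushout.inr_desc_assoc, zero_comp]; exact hk.symm
      mono_f := Abelian.mono_pushout_of_mono_f S.f u
      epi_g := hq }
  refine ⟨pushout S.f u, _, q, w, hT, ?_⟩
  have := ShortComplex.ShortExact.extClass_naturality hS hT
    { τ₁ := u, τ₂ := pushout.inl S.f u, τ₃ := 𝟙 M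
      comm₁₂ := pushout.condition.symm
      comm₂₃ := by
        change pushout.inl S.f u ≫ q = S.g ≫ 𝟙 M
        rw [pushout.inl_desc, Category.comp_id] }
  rw [← hx]
  refine Eq.trans ?_ this.symm
  exact (Ext.mk₀_id_comp _).symm

/-- The middle term is determined by the class up to isomorphism. -/
theorem IsMiddle.nonempty_iso {M N : ModuleCat.{u} A} {α : Ext M N 1} {E E' : ModuleCat.{u} A}
    (h : IsMiddle α E) (h' : IsMiddle α E') : Nonempty (E ≅ E') := by
  obtain ⟨i, q, w, hS, rfl⟩ := h
  obtain ⟨i', q', w', hS', e⟩ := h'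
  obtain ⟨f, hf⟩ := Ext.covariant_sequence_exact₃ E hS' (Ext.mk₀ q) (zero_add 1)
    (by rw [e]; exact hS.comp_extClass)
  obtain ⟨f, rfl⟩ := (Ext.mk₀_bijective _ _).2 f
  rw [Ext.mk₀_comp_mk₀] at hf
  have hf : f ≫ q' = q := (Ext.mk₀_bijective _ _).1 hf
  have hi : (i ≫ f) ≫ q' = 0 := by rw [Category.assoc, hf, w]
  have := hS'.mono_f
  have := hS.mono_f
  let a : N ⟶ N := hS'.exact.lift (i ≫ f) hi
  have ha : a ≫ i' = i ≫ f := hS'.exact.lift_f _ _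
  have nat := ShortComplex.ShortExact.extClass_naturality hS hS'
    { τ₁ := a, τ₂ := f, τ₃ := 𝟙 M
      comm₁₂ := ha
      comm₂₃ := by change f ≫ q' = q ≫ 𝟙 M; rw [hf, Category.comp_id] }
  have nat : hS.extClass.comp (Ext.mk₀ a) (add_zero 1) = hS.extClass := by
    refine nat.trans ?_
    rw [e]
    exact Ext.mk₀_id_comp _
  obtain ⟨b, hb⟩ := Ext.contravariant_sequence_exact₁ hS N (Ext.mk₀ (a - 𝟙 N)) (add_zero 1) (by
    have h1 : Ext.mk₀ a = Ext.mk₀ (a - 𝟙 N) + Ext.mk₀ (𝟙 N) := by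
      rw [← Ext.mk₀_add, sub_add_cancel]
    have h2 : hS.extClass.comp (Ext.mk₀ (𝟙 N)) (add_zero 1) = hS.extClass := Ext.comp_mk₀_id _
    rw [h1, Ext.comp_add, h2] at nat
    exact add_eq_right.1 nat)
  obtain ⟨b, rfl⟩ := (Ext.mk₀_bijective _ _).2 b
  rw [Ext.mk₀_comp_mk₀] at hb
  have hb : i ≫ b = a - 𝟙 N := (Ext.mk₀_bijective _ _).1 hb
  let φ : ShortComplex.mk i q w ⟶ ShortComplex.mk i' q' w' :=
    { τ₁ := 𝟙 N, τ₂ := f - b ≫ i', τ₃ := 𝟙 M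
      comm₁₂ := by
        change 𝟙 N ≫ i' = i ≫ (f - b ≫ i')
        rw [Preadditive.comp_sub, ← Category.assoc i b, hb, Preadditive.sub_comp, ha]
        simp
      comm₂₃ := by
        change (f - b ≫ i') ≫ q' = q ≫ 𝟙 M
        rw [Preadditive.sub_comp, Category.assoc, w', hf]
        simp }
  have : IsIso φ.τ₁ := inferInstanceAs (IsIso (𝟙 N))
  have : IsIso φ.τ₃ := inferInstanceAs (IsIso (𝟙 M))
  have : IsIso φ.τ₂ := ShortComplex.isIso₂_of_shortExact_of_isIso₁₃ φ hS hS'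
  exact ⟨asIso φ.τ₂⟩

/-- A middle term of an extension representing `α`, unique up to isomorphism. -/
def middle {M N : ModuleCat.{u} A} (α : Ext M N 1) : ModuleCat.{u} A :=
  (exists_isMiddle α).choose

theorem isMiddle_middle {M N : ModuleCat.{u} A} (α : Ext M N 1) : IsMiddle α (middle α) :=
  (exists_isMiddle α).choose_spec

/-! ### The function `e^T` -/

/-- The sequence `n ↦ (d-1)! / n^(d-1) * ℓ(Tor₁(M, A / F (n+1)))`. (The lengths are finite for `M`
finitely generated over a Noetherian local ring and `F (n+1)` an `𝔪`-primary ideal.) -/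
def torSeq (d : ℕ) (F : ℕ → Ideal A) (M : ModuleCat.{u} A) (n : ℕ) : ℝ :=
  ((d - 1).factorial : ℝ) / (n : ℝ) ^ (d - 1) *
    ((Module.length A (((Tor (ModuleCat.{u} A) 1).obj M).obj
      (ModuleCat.of A (A ⧸ F (n + 1))))).toNat : ℝ)

/-- `e^T_F(M)`, the limit of `torSeq d F M`, for a local ring of dimension `d`. -/
def eT (d : ℕ) (F : ℕ → Ideal A) (M : ModuleCat.{u} A) : ℝ :=
  limUnder atTop (torSeq d F M)

theorem eT_congr (d : ℕ) (F : ℕ → Ideal A) {M M' : ModuleCat.{u} A} (e : M ≅ M') :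
    eT d F M = eT d F M' := by
  have : torSeq d F M = torSeq d F M' := by
    funext n
    unfold torSeq
    rw [(((Tor (ModuleCat.{u} A) 1).mapIso e).app
      (ModuleCat.of A (A ⧸ F (n + 1)))).toLinearEquiv.length_eq]
  rw [eT, eT, this]

/-- `e^T_F(α) = e^T_F(M) + e^T_F(N) - e^T_F(E)` for `α` represented by `0 → N → E → M → 0`. -/
def eTClass (d : ℕ) (F : ℕ → Ideal A) {M N : ModuleCat.{u} A} (α : Ext M N 1) : ℝ :=
  eT d F M + eT d F N - eT d F (middle α)

/-- `eTClass` may be computed from any extension representing the class. -/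
theorem eTClass_eq (d : ℕ) (F : ℕ → Ideal A) {M N : ModuleCat.{u} A} {α : Ext M N 1}
    {E : ModuleCat.{u} A} (h : IsMiddle α E) :
    eTClass d F α = eT d F M + eT d F N - eT d F E := by
  obtain ⟨e⟩ := (isMiddle_middle α).nonempty_iso h
  rw [eTClass, eT_congr d F e]

/-- The set `T_F(M, N)` of `T_F`-split classes. -/
def splitClasses (d : ℕ) (F : ℕ → Ideal A) (M N : ModuleCat.{u} A) : Set (Ext M N 1) :=
  {α | eTClass d F α = 0}

/-- The quotient `Ext¹(M, N) / T`, regarded as a vector space over a field `k` mapping to `A`. -/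
def QuotientSpace (k : Type v) [Field k] [Algebra k A] {M N : ModuleCat.{u} A}
    (T : Submodule A (Ext M N 1)) : Type u :=
  Ext M N 1 ⧸ T

instance (k : Type v) [Field k] [Algebra k A] {M N : ModuleCat.{u} A}
    (T : Submodule A (Ext M N 1)) : AddCommGroup (QuotientSpace k T) :=
  inferInstanceAs (AddCommGroup (Ext M N 1 ⧸ T))

/-- `c ∈ k` acts as its image in `A`. -/
instance (k : Type v) [Field k] [Algebra k A] {M N : ModuleCat.{u} A}
    (T : Submodule A (Ext M N 1)) : Module k (QuotientSpace k T) :=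
  Module.compHom (Ext M N 1 ⧸ T) (algebraMap k A)

/-- The image of a class `α` in `Ext¹(M, N) / T`. -/
def toQuotient (k : Type v) [Field k] [Algebra k A] {M N : ModuleCat.{u} A}
    (T : Submodule A (Ext M N 1)) (α : Ext M N 1) : QuotientSpace k T :=
  (Submodule.Quotient.mk α : Ext M N 1 ⧸ T)

end

end TSplit

end

/-!
The function `e^T` is additive on direct sums and subadditive on short exact sequences of finitely
generated modules, and everything about classes of extensions follows from this. If `X`, `Y` and `E`
are the middle terms of `α`, `β` and `α + β` in `Ext¹(M, N)`, then the pullback of `α` along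
`X → M` splits, so that `β` and `α + β` have the same pullback `P`. Hence there are exact sequences
`0 → P → Y ⊕ X → M → 0` and `0 → N → P → E → 0`, which give
`e^T(X) + e^T(Y) ≤ e^T(M) + e^T(N) + e^T(E)`, that is `e^T(α + β) ≤ e^T(α) + e^T(β)`
(`TSplit.eTClass_add_le`). Similarly `a • α` is the pullback of `α` along multiplication by `a` on
`M`, whence `e^T(a • α) ≤ e^T(α)` (`TSplit.eTClass_smul_le`). As `e^T` is non-negative on classes,
the split classes form a submodule, and translation by a split class or multiplication by a unit does
not change `e^T`.

The existence of the limits is Hilbert–Samuel theory. Both kinds of filtrations are `I`-admissible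
for an `𝔪`-primary ideal `I`. For a presentation `0 → S → L → M → 0` with `L` free of finite rank,
`Tor₁(M, A / F n)` has the length of `(S ∩ F n L) / F n S`, a quotient of two stable `I`-filtrations
of `S`. Such a length is eventually a polynomial function of `n`, by the Hilbert–Serre induction on
the number of generators of `I` (`TSplit.eventuallyPoly_colength_sub`). By Artin–Rees it is bounded
by a difference of values of the Hilbert–Samuel function of `S`, hence it is of degree at most
`d - 1` (`TSplit.IsAdmissible.eventuallyPoly_torLength`), and its normalised leading coefficient is
an integer (`TSplit.EventuallyPoly.exists_tendsto`). Subadditivity is read off from the description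
of `Tor₁(M, P / K)` as the kernel of `M ⊗ K → M ⊗ P`, for `P` flat (`TSplit.exists_tor_equiv`).
-/

/-! ### Integer-valued functions of polynomial type -/

namespace TSplit

open Asymptotics

/-- `g : ℕ → ℤ` agrees for large arguments with a polynomial function of degree `< D`, expressed
by the eventual vanishing of the `D`-th iterated forward difference. -/
def EventuallyPoly (D : ℕ) (g : ℕ → ℤ) : Prop :=
  ∀ᶠ n in atTop, (fwdDiff 1)^[D] g n = 0

namespace EventuallyPoly

theorem eventuallyEq_fwdDiff_iter {g g' : ℕ → ℤ} (h : g =ᶠ[atTop] g') (D : ℕ) :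
    (fwdDiff 1)^[D] g =ᶠ[atTop] (fwdDiff 1)^[D] g' := by
  induction D generalizing g g' with
  | zero => exact h
  | succ D ih =>
    rw [Function.iterate_succ_apply, Function.iterate_succ_apply]
    refine ih ?_
    filter_upwards [h, (tendsto_add_atTop_nat 1).eventually h] with n h1 h2
    simp only [fwdDiff, h1, h2]

theorem congr {D : ℕ} {g g' : ℕ → ℤ} (hg : EventuallyPoly D g) (h : g =ᶠ[atTop] g') :
    EventuallyPoly D g' := by
  filter_upwards [hg, eventuallyEq_fwdDiff_iter h D] with n h1 h2
  rw [← h2, h1]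

theorem succ_iff {D : ℕ} {g : ℕ → ℤ} :
    EventuallyPoly (D + 1) g ↔ EventuallyPoly D (fwdDiff 1 g) := by
  simp only [EventuallyPoly, Function.iterate_succ_apply]

theorem succ {D : ℕ} {g : ℕ → ℤ} (h : EventuallyPoly D g) : EventuallyPoly (D + 1) g := by
  filter_upwards [h, (tendsto_add_atTop_nat 1).eventually h] with n h1 h2
  rw [Function.iterate_succ_apply', fwdDiff, h1, h2, sub_zero]

theorem mono {D D' : ℕ} {g : ℕ → ℤ} (h : EventuallyPoly D g) (hD : D ≤ D') :
    EventuallyPoly D' g := by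
  induction hD with
  | refl => exact h
  | step _ ih => exact ih.succ

theorem add {D : ℕ} {g g' : ℕ → ℤ} (h : EventuallyPoly D g) (h' : EventuallyPoly D g') :
    EventuallyPoly D (g + g') := by
  filter_upwards [h, h'] with n h1 h2
  rw [fwdDiff_iter_add, Pi.add_apply, h1, h2, add_zero]

theorem neg {D : ℕ} {g : ℕ → ℤ} (h : EventuallyPoly D g) : EventuallyPoly D (-g) := by
  filter_upwards [h] with n h1
  have := congrFun (fwdDiff_iter_const_smul (1 : ℕ) (-1 : ℤ) g D) n
  simpa [h1] using this

theorem sub {D : ℕ} {g g' : ℕ → ℤ} (h : EventuallyPoly D g) (h' : EventuallyPoly D g') :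
    EventuallyPoly D (g - g') := by
  rw [sub_eq_add_neg]
  exact h.add h'.neg

theorem shift {D : ℕ} {g : ℕ → ℤ} (h : EventuallyPoly D g) (c : ℕ) :
    EventuallyPoly D (fun n ↦ g (n + c)) := by
  filter_upwards [(tendsto_add_atTop_nat c).eventually h] with n h1
  rw [← h1]
  exact fwdDiff_iter_comp_add 1 g c D n

theorem of_shift {D : ℕ} {g : ℕ → ℤ} (c : ℕ) (h : EventuallyPoly D (fun n ↦ g (n + c))) :
    EventuallyPoly D g := by
  rw [EventuallyPoly, ← map_add_atTop_eq_nat c, eventually_map]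
  filter_upwards [h] with n h1
  rw [← h1]
  exact (fwdDiff_iter_comp_add 1 g c D n).symm

theorem shift_sub {D : ℕ} {g : ℕ → ℤ} (h : EventuallyPoly (D + 1) g) (c : ℕ) :
    EventuallyPoly D (fun n ↦ g (n + c) - g n) := by
  induction c with
  | zero =>
    refine Eventually.of_forall fun n ↦ ?_
    simp only [add_zero, sub_self]
    clear h
    induction D generalizing n with
    | zero => rfl
    | succ D ih => simp [Function.iterate_succ_apply', fwdDiff, ih]
  | succ c ih =>
    refine (ih.add ((succ_iff.1 h).shift c)).congr (Eventually.of_forall fun n ↦ ?_)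
    simp only [Pi.add_apply, fwdDiff]
    rw [show n + c + 1 = n + (c + 1) by ring]
    ring

/-- The normalised leading coefficient of a polynomial function with integer values is an
integer. -/
theorem exists_tendsto {D : ℕ} {g : ℕ → ℤ} (h : EventuallyPoly (D + 1) g) :
    ∃ c : ℤ, (∀ᶠ n in atTop, (fwdDiff 1)^[D] g n = c) ∧
      Tendsto (fun n : ℕ ↦ (D.factorial : ℝ) / (n : ℝ) ^ D * (g n : ℝ)) atTop (𝓝 (c : ℝ)) := by
  obtain ⟨N, hN⟩ := eventually_atTop.1 h
  have hc : ∀ n ≥ N, (fwdDiff 1)^[D] g n = (fwdDiff 1)^[D] g N := by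
    intro n hn
    induction n, hn using Nat.le_induction with
    | base => rfl
    | succ n hn ih =>
      have := hN n hn
      rw [Function.iterate_succ_apply', fwdDiff] at this
      rw [← ih]
      exact sub_eq_zero.1 this
  set c := (fwdDiff 1)^[D] g N
  refine ⟨c, eventually_atTop.2 ⟨N, hc⟩, ?_⟩
  clear_value c
  induction D generalizing g c with
  | zero =>
    refine tendsto_const_nhds.congr' ?_
    filter_upwards [eventually_ge_atTop N] with n hn
    simp [← hc n hn]
  | succ D ih =>
    -- Subtracting `c * n.choose (D + 1)` lowers the degree.
    let g' : ℕ → ℤ := g + (-c) • fun n ↦ (n.choose (D + 1) : ℤ)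
    have hg'0 : ∀ n ≥ N, (fwdDiff 1)^[D + 1] g' n = 0 := by
      intro n hn
      have h1 := hc n hn
      have h2 := congrFun (fwdDiff_iter_choose 0 (D + 1)) n
      simp only [add_zero] at h2
      rw [fwdDiff_iter_add, fwdDiff_iter_const_smul, Pi.add_apply, Pi.smul_apply, h1, h2]
      simp
    have hg' : EventuallyPoly (D + 1) g' := eventually_atTop.2 ⟨N, hg'0⟩
    have hconst : ∀ n ≥ N, (fwdDiff 1)^[D] g' n = (fwdDiff 1)^[D] g' N := by
      intro n hn
      induction n, hn using Nat.le_induction with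
      | base => rfl
      | succ n hn ih =>
        have := hg'0 n hn
        rw [Function.iterate_succ_apply', fwdDiff] at this
        rw [← ih]
        exact sub_eq_zero.1 this
    have key := ih hg' hg'0 _ hconst
    have hinv : Tendsto (fun n : ℕ ↦ ((D + 1 : ℕ) : ℝ) / (n : ℝ)) atTop (𝓝 0) :=
      tendsto_const_div_atTop_nhds_zero_nat _
    have h1 := key.mul hinv
    rw [mul_zero] at h1
    have h2 : Tendsto (fun n : ℕ ↦ ((D + 1).factorial : ℝ) / (n : ℝ) ^ (D + 1) *
        (n.choose (D + 1) : ℝ)) atTop (𝓝 1) := by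
      have := (isEquivalent_choose (D + 1))
      have h3 := (isEquivalent_iff_tendsto_one (by
        filter_upwards [eventually_gt_atTop 0] with n hn
        positivity)).1 this
      refine h3.congr fun n ↦ ?_
      simp only [Pi.div_apply]
      rw [div_div_eq_mul_div]
      ring
    have h4 := h1.add (h2.const_mul (c : ℝ))
    rw [zero_add, mul_one] at h4
    refine h4.congr' ?_
    filter_upwards [eventually_gt_atTop 0] with n hn
    have : (n : ℝ) ≠ 0 := by positivity
    simp only [g', Pi.add_apply, Pi.smul_apply, smul_eq_mul, Int.cast_add, Int.cast_mul,
      Int.cast_neg, Int.cast_natCast, Nat.factorial_succ, Nat.cast_mul]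
    field_simp
    ring

theorem isBigO {D : ℕ} {g : ℕ → ℤ} (h : EventuallyPoly (D + 1) g) :
    (fun n ↦ (g n : ℝ)) =O[atTop] (fun n : ℕ ↦ (n : ℝ) ^ D) := by
  obtain ⟨c, -, hc⟩ := h.exists_tendsto
  have h1 := (hc.isBigO_one ℝ).mul
    (isBigO_refl (fun n : ℕ ↦ (n : ℝ) ^ D * (D.factorial : ℝ)⁻¹) atTop)
  refine (h1.congr' ?_ (Eventually.of_forall fun n ↦ one_mul _)).trans ?_
  · filter_upwards [eventually_gt_atTop 0] with n hn
    have : (n : ℝ) ≠ 0 := by positivity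
    have : (D.factorial : ℝ) ≠ 0 := by positivity
    field_simp
  · exact (isBigO_const_mul_self (D.factorial : ℝ)⁻¹ _ _).congr_left fun n ↦ mul_comm _ _

/-- The degree of a polynomial function is bounded by its order of growth. -/
theorem of_isBigO {D e : ℕ} {g : ℕ → ℤ} (h : EventuallyPoly D g)
    (hO : (fun n ↦ (g n : ℝ)) =O[atTop] (fun n : ℕ ↦ (n : ℝ) ^ e)) :
    EventuallyPoly (e + 1) g := by
  induction D with
  | zero => exact h.mono (Nat.zero_le _)
  | succ k ih =>
    rcases Nat.lt_or_ge e k with hk | hk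
    · refine ih ?_
      obtain ⟨c, hc, ht⟩ := h.exists_tendsto
      have ho : (fun n : ℕ ↦ (n : ℝ) ^ e) =o[atTop] (fun n : ℕ ↦ (n : ℝ) ^ k) :=
        (isLittleO_pow_pow_atTop_of_lt hk).comp_tendsto tendsto_natCast_atTop_atTop
      have h0 := ((hO.trans_isLittleO ho).tendsto_div_nhds_zero).const_mul (k.factorial : ℝ)
      rw [mul_zero] at h0
      have : (c : ℝ) = 0 := tendsto_nhds_unique ht (h0.congr fun n ↦ by ring)
      have hc0 : c = 0 := by exact_mod_cast this
      rw [hc0] at hc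
      exact hc
    · exact h.mono (by omega)

end EventuallyPoly

end TSplit

/-! ### Hilbert functions of stable filtrations -/

namespace TSplit

section Colength

variable {A : Type*} [CommRing A] {M : Type*} [AddCommGroup M] [Module A M]

/-- The length of `M ⧸ P` as a natural number, with value `0` if that length is infinite. -/
noncomputable def colength (P : Submodule A M) : ℕ := (Module.length A (M ⧸ P)).toNat

theorem length_quotient_eq_add {P Q : Submodule A M} (h : P ≤ Q) :
    Module.length A (M ⧸ P) =
      Module.length A (LinearMap.range (P.mkQ ∘ₗ Q.subtype)) + Module.length A (M ⧸ Q) := by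
  refine Module.length_eq_add_of_exact (LinearMap.range (P.mkQ ∘ₗ Q.subtype)).subtype
    (Submodule.factor h) (Submodule.injective_subtype _) (Submodule.factor_surjective h) ?_
  intro x
  obtain ⟨m, rfl⟩ := P.mkQ_surjective x
  constructor
  · intro hm
    have hm' : m ∈ Q := by simpa using hm
    exact ⟨⟨_, ⟨⟨m, hm'⟩, rfl⟩⟩, rfl⟩
  · rintro ⟨⟨_, ⟨⟨y, hy⟩, rfl⟩⟩, e⟩
    rw [← e]
    simpa using hy

theorem length_quotient_anti {P Q : Submodule A M} (h : P ≤ Q) :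
    Module.length A (M ⧸ Q) ≤ Module.length A (M ⧸ P) := by
  rw [length_quotient_eq_add h]
  exact le_add_self

theorem length_quotient_ne_top_of_le {P Q : Submodule A M} (h : P ≤ Q)
    (hP : Module.length A (M ⧸ P) ≠ ⊤) : Module.length A (M ⧸ Q) ≠ ⊤ :=
  ne_top_of_le_ne_top hP (length_quotient_anti h)

theorem colength_eq_add {P Q : Submodule A M} (h : P ≤ Q)
    (hP : Module.length A (M ⧸ P) ≠ ⊤) :
    colength P =
      (Module.length A (LinearMap.range (P.mkQ ∘ₗ Q.subtype))).toNat + colength Q := by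
  have e := length_quotient_eq_add h
  rw [colength, e, ENat.toNat_add, colength]
  · exact fun h' ↦ hP (by rw [e, h', top_add])
  · exact length_quotient_ne_top_of_le h hP

theorem colength_anti {P Q : Submodule A M} (h : P ≤ Q)
    (hP : Module.length A (M ⧸ P) ≠ ⊤) : colength Q ≤ colength P := by
  rw [colength_eq_add h hP]
  exact Nat.le_add_left _ _

/-- Multiplication by `f` induces an isomorphism from `L / ((K : f) ∩ L)` onto
`(K + f L) / K`. -/
theorem colength_sub_colength_smul (f : A) (K L : Submodule A M) (K' : Submodule A M)
    (hK' : K' = K.comap (LinearMap.lsmul A M f) ⊓ L)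
    (hfin : Module.length A (M ⧸ K) ≠ ⊤) (hfin' : Module.length A (M ⧸ K') ≠ ⊤) :
    (colength K' : ℤ) - colength L =
      colength K - colength (K ⊔ L.map (LinearMap.lsmul A M f)) := by
  have hK'L : K' ≤ L := hK' ▸ inf_le_right
  rw [colength_eq_add hK'L hfin', colength_eq_add (le_sup_left : K ≤ K ⊔ _) hfin]
  set φ : L →ₗ[A] M ⧸ K := (K.mkQ ∘ₗ LinearMap.lsmul A M f) ∘ₗ L.subtype
  have hr : LinearMap.range (K.mkQ ∘ₗ (K ⊔ L.map (LinearMap.lsmul A M f)).subtype) =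
      LinearMap.range φ := by
    rw [LinearMap.range_comp, LinearMap.range_comp, Submodule.range_subtype,
      Submodule.range_subtype, Submodule.map_sup, Submodule.map_comp]
    simp
  have hk : LinearMap.ker (K'.mkQ ∘ₗ L.subtype) = LinearMap.ker φ := by
    ext ⟨x, hx⟩
    simp only [φ, hK', LinearMap.mem_ker, LinearMap.comp_apply, Submodule.mkQ_apply,
      Submodule.subtype_apply, Submodule.Quotient.mk_eq_zero, Submodule.mem_inf, hx, and_true,
      Submodule.mem_comap]
  have e := (LinearMap.quotKerEquivRange (K'.mkQ ∘ₗ L.subtype)).symm.trans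
    ((Submodule.quotEquivOfEq _ _ hk).trans φ.quotKerEquivRange)
  rw [hr, e.length_eq]
  push_cast
  ring

end Colength

section HilbertFunction

variable {A : Type*} [CommRing A] [IsNoetherianRing A] {M : Type*} [AddCommGroup M] [Module A M]
  [Module.Finite A M]

/-- The Hilbert function of the quotient of two stable filtrations is of polynomial type, of degree
less than the number of elements needed to generate `I` modulo an ideal `J` which acts trivially on
the associated graded quotient. This is the inductive proof of the Hilbert–Serre theorem by means of
the kernel and the cokernel of multiplication by one of the generators. -/
theorem eventuallyPoly_colength_sub {I : Ideal A} (s : Finset A) (J : Ideal A)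
    (hI : I = J ⊔ Ideal.span (s : Set A)) (K L : I.Filtration M) (hKL : K ≤ L) (hL : L.Stable)
    (hJ : ∀ n, J • L.N n ≤ K.N (n + 1)) (hfin : ∀ n, Module.length A (M ⧸ K.N n) ≠ ⊤) :
    EventuallyPoly s.card (fun n ↦ (colength (K.N n) : ℤ) - colength (L.N n)) := by
  classical
  induction s using Finset.induction_on generalizing J K L with
  | empty =>
    obtain ⟨n₀, hn₀⟩ := hL
    refine eventually_atTop.2 ⟨n₀ + 1, fun n hn ↦ ?_⟩
    obtain ⟨n, rfl⟩ := Nat.exists_eq_add_of_le' hn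
    have : K.N (n + (n₀ + 1)) = L.N (n + (n₀ + 1)) := by
      refine le_antisymm (hKL _) ?_
      rw [← add_assoc, ← hn₀ _ (by omega)]
      have hIJ : I = J := by simpa using hI
      exact (Submodule.smul_mono_left hIJ.le).trans (hJ _)
    simp [this]
  | insert f s hf ih =>
    have hI' : I = (J ⊔ Ideal.span {f}) ⊔ Ideal.span (s : Set A) := by
      rw [hI, Finset.coe_insert, Ideal.span_insert, sup_assoc]
    have hfI : f ∈ I := by
      rw [hI']
      exact Ideal.mem_sup_left (Ideal.mem_sup_right (Ideal.mem_span_singleton_self f))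
    have hfmul : ∀ (F : I.Filtration M) n x, x ∈ F.N n → f • x ∈ F.N (n + 1) :=
      fun F n x hx ↦ F.smul_le n (Submodule.smul_mem_smul hfI hx)
    have hJ' : ∀ (P Q : ℕ → Submodule A M), (∀ n, P n ≤ L.N n) → (∀ n, K.N n ≤ Q n) →
        (∀ n, ∀ x ∈ P n, f • x ∈ Q (n + 1)) →
        ∀ n, (J ⊔ Ideal.span {f}) • P n ≤ Q (n + 1) := by
      intro P Q hP hQ h n
      rw [Submodule.sup_smul, sup_le_iff]
      refine ⟨(Submodule.smul_mono le_rfl (hP n)).trans ((hJ n).trans (hQ _)), ?_⟩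
      rw [Submodule.ideal_span_singleton_smul]
      rintro _ ⟨x, hx, rfl⟩
      exact h n x hx
    -- The kernel of multiplication by `f`.
    let K' : I.Filtration M :=
      { N := fun n ↦ (K.N (n + 1)).comap (LinearMap.lsmul A M f) ⊓ L.N n
        mono := fun n ↦ inf_le_inf (Submodule.comap_mono (K.mono _)) (L.mono _)
        smul_le := fun n ↦ by
          refine Submodule.smul_le.2 fun r hr x hx ↦ ⟨?_, ?_⟩
          · have := K.smul_le _ (Submodule.smul_mem_smul hr hx.1)
            simpa [smul_comm r f x] using this
          · exact L.smul_le _ (Submodule.smul_mem_smul hr hx.2) }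
    -- The cokernel of multiplication by `f`.
    let K'' : I.Filtration M :=
      { N := fun n ↦ K.N n ⊔ (L.N (n - 1)).map (LinearMap.lsmul A M f)
        mono := fun n ↦ sup_le_sup (K.mono _) (Submodule.map_mono (L.antitone (by omega)))
        smul_le := fun n ↦ by
          rw [Submodule.smul_sup]
          refine sup_le_sup (K.smul_le n) ?_
          rw [← Submodule.map_smul'']
          refine Submodule.map_mono ?_
          rcases n with _ | n
          · exact Submodule.smul_le_right
          · exact L.smul_le n }
    have hKK' : ∀ n, K.N n ≤ K'.N n := fun n x hx ↦ ⟨hfmul K n x hx, hKL n hx⟩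
    have hKK'' : ∀ n, K.N n ≤ K''.N n := fun n ↦ le_sup_left
    have hK'L : K' ≤ L := fun n ↦ inf_le_right
    have hK''L : K'' ≤ L := by
      intro n
      refine sup_le (hKL n) ?_
      rintro _ ⟨x, hx, rfl⟩
      rcases n with _ | n
      · exact (L.N 0).smul_mem f hx
      · exact hfmul L n x hx
    have h1 := ih (J ⊔ Ideal.span {f}) hI' K K' hKK' (hL.of_le hK'L)
      (hJ' _ _ hK'L (fun _ ↦ le_rfl) fun n x hx ↦ hx.1) hfin
    have h2 := ih (J ⊔ Ideal.span {f}) hI' K'' L hK''L hL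
      (hJ' _ _ (fun _ ↦ le_rfl) hKK'' fun n x hx ↦
        Submodule.mem_sup_right (Submodule.mem_map_of_mem hx))
      fun n ↦ length_quotient_ne_top_of_le (hKK'' n) (hfin n)
    rw [Finset.card_insert_of_notMem hf, EventuallyPoly.succ_iff]
    refine ((h2.shift 1).sub h1).congr (Eventually.of_forall fun n ↦ ?_)
    have := colength_sub_colength_smul f (K.N (n + 1)) (L.N n) (K'.N n) rfl (hfin _)
      (length_quotient_ne_top_of_le (hKK' n) (hfin n))
    have e : K''.N (n + 1) = K.N (n + 1) ⊔ (L.N n).map (LinearMap.lsmul A M f) := rfl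
    simp only [Pi.sub_apply, fwdDiff, e]
    linarith

theorem eventuallyPoly_colength_pow_smul (s : Finset A)
    (hfin : ∀ n, Module.length A (M ⧸ (Ideal.span (s : Set A) ^ n • ⊤ : Submodule A M)) ≠ ⊤) :
    EventuallyPoly (s.card + 1)
      (fun n ↦ (colength (Ideal.span (s : Set A) ^ n • ⊤ : Submodule A M) : ℤ)) := by
  set I := Ideal.span (s : Set A)
  let L : I.Filtration M := I.stableFiltration ⊤
  let K : I.Filtration M :=
    { N := fun n ↦ L.N (n + 1)
      mono := fun n ↦ L.mono _
      smul_le := fun n ↦ L.smul_le _ }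
  have := eventuallyPoly_colength_sub s ⊥ (by simp [I]) K L (fun n ↦ L.mono n)
    (I.stableFiltration_stable ⊤) (by simp) fun n ↦ hfin (n + 1)
  exact EventuallyPoly.succ_iff.2 this

end HilbertFunction

section Radical

variable {A : Type*} [CommRing A] [IsLocalRing A]

theorem maximalIdeal_mem_minimalPrimes {I : Ideal A} (hI : I.radical = maximalIdeal A) :
    maximalIdeal A ∈ I.minimalPrimes := by
  rw [← Ideal.radical_minimalPrimes, hI, Ideal.minimalPrimes_eq_subsingleton_self]
  rfl

theorem radical_eq_maximalIdeal {I : Ideal A} (hI : maximalIdeal A ∈ I.minimalPrimes) :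
    I.radical = maximalIdeal A := by
  refine le_antisymm ?_ ?_
  · exact ((maximalIdeal.isMaximal A).isPrime.radical_le_iff).2 hI.1.2
  · rw [← Ideal.sInf_minimalPrimes]
    refine le_sInf fun p hp ↦ hI.2 ⟨hp.1.1, hp.1.2⟩ (le_maximalIdeal hp.1.1.ne_top)

theorem radical_pow_eq_maximalIdeal {I : Ideal A} (hI : I.radical = maximalIdeal A) {n : ℕ}
    (hn : n ≠ 0) : (I ^ n).radical = maximalIdeal A := by
  rw [Ideal.radical_pow I hn, hI]

end Radical

section Local

variable {A : Type*} [CommRing A] [IsLocalRing A] [IsNoetherianRing A]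
  {M : Type*} [AddCommGroup M] [Module A M] [Module.Finite A M]

/-- Modules annihilated by an `𝔪`-primary ideal are of finite length. -/
theorem length_ne_top_of_radical {I : Ideal A} (hI : I.radical = maximalIdeal A)
    (hM : I ≤ Module.annihilator A M) : Module.length A M ≠ ⊤ := by
  have : IsArtinianRing (A ⧸ I) :=
    quotient_artinian_of_mem_minimalPrimes_of_isLocalRing I (maximalIdeal_mem_minimalPrimes hI)
  have hM' : Module.IsTorsionBySet A M I := fun m a ↦ Module.mem_annihilator.1 (hM a.2) m
  let _ : Module (A ⧸ I) M := hM'.module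
  have : IsScalarTower A (A ⧸ I) M := hM'.isScalarTower
  have : Module.Finite (A ⧸ I) M := Module.Finite.of_restrictScalars_finite A _ _
  have : IsArtinian (A ⧸ I) M := isArtinian_of_fg_of_artinian'
  have : IsArtinian A M := isArtinian_of_surjective_algebraMap (R := A ⧸ I)
    Ideal.Quotient.mk_surjective
  exact Module.length_ne_top

theorem length_quotient_smul_ne_top {I : Ideal A} (hI : I.radical = maximalIdeal A) :
    Module.length A (M ⧸ (I • ⊤ : Submodule A M)) ≠ ⊤ := by
  refine length_ne_top_of_radical hI fun a ha ↦ Module.mem_annihilator.2 fun m ↦ ?_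
  obtain ⟨m, rfl⟩ := Submodule.mkQ_surjective _ m
  rw [← map_smul, Submodule.mkQ_apply, Submodule.Quotient.mk_eq_zero]
  exact Submodule.smul_mem_smul ha Submodule.mem_top

theorem length_quotient_pow_smul_ne_top {I : Ideal A} (hI : I.radical = maximalIdeal A) (n : ℕ) :
    Module.length A (M ⧸ (I ^ n • ⊤ : Submodule A M)) ≠ ⊤ :=
  length_quotient_ne_top_of_le (Submodule.smul_mono_left (Ideal.pow_le_pow_right n.le_succ))
    (length_quotient_smul_ne_top (radical_pow_eq_maximalIdeal hI n.succ_ne_zero))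

open Asymptotics in
/-- The Hilbert–Samuel function of a finite module over a local ring of dimension `d` is of
polynomial type of degree at most `d`. The degree bound comes from comparing the powers of `I`
with those of an ideal generated by a system of parameters. -/
theorem eventuallyPoly_hilbertSamuel {d : ℕ} (hdim : ringKrullDim A = d) {I : Ideal A}
    (hI : I.radical = maximalIdeal A) :
    EventuallyPoly (d + 1) (fun n ↦ (colength (I ^ n • ⊤ : Submodule A M) : ℤ)) := by
  obtain ⟨t, ht⟩ := (inferInstance : IsNoetherianRing A).noetherian I
  have hfin := length_quotient_pow_smul_ne_top (M := M) hI
  have hpoly : EventuallyPoly (t.card + 1)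
      (fun n ↦ (colength (I ^ n • ⊤ : Submodule A M) : ℤ)) := by
    subst ht
    exact eventuallyPoly_colength_pow_smul t hfin
  refine hpoly.of_isBigO ?_
  obtain ⟨s, hs, hcard⟩ := (maximalIdeal A).exists_finset_card_eq_height_of_isNoetherianRing
  have hsd : s.card = d := by
    have := maximalIdeal_height_eq_ringKrullDim (R := A)
    rw [← hcard, hdim] at this
    exact_mod_cast this
  set q := Ideal.span (s : Set A)
  have hq := radical_eq_maximalIdeal hs
  obtain ⟨r, hr⟩ := Ideal.exists_pow_le_of_le_radical_of_fg
    (show q ≤ I.radical from hI ▸ hq ▸ Ideal.le_radical) (IsNoetherian.noetherian q)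
  have hqfin := length_quotient_pow_smul_ne_top (M := M) hq
  have hq1 := hsd ▸ (eventuallyPoly_colength_pow_smul s hqfin).isBigO
  -- `q ^ ((r + 1) * n) ≤ I ^ n`
  have hle : ∀ n, q ^ ((r + 1) * n) ≤ I ^ n := fun n ↦ by
    rw [pow_mul]
    exact Ideal.pow_right_mono ((Ideal.pow_le_pow_right r.le_succ).trans hr) n
  have htend : Tendsto (fun n ↦ (r + 1) * n) atTop atTop :=
    tendsto_id.const_mul_atTop' (Nat.succ_pos r)
  have h3 := hq1.comp_tendsto htend
  refine (IsBigO.of_bound 1 (Eventually.of_forall fun n ↦ ?_)).trans (h3.trans ?_)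
  · have := colength_anti (Submodule.smul_mono_left (N := (⊤ : Submodule A M)) (hle n)) (hqfin _)
    simp only [Function.comp_apply, Int.cast_natCast, one_mul, Real.norm_natCast]
    exact_mod_cast this
  · refine (isBigO_const_mul_self (((r + 1 : ℕ) : ℝ) ^ d) _ _).congr_left fun n ↦ ?_
    simp only [Function.comp_apply]
    push_cast
    rw [mul_pow]

end Local

end TSplit

/-! ### First Tor modules as kernels -/

namespace TSplit

open scoped TensorProduct

section LinearAlgebra

variable {A : Type*} [CommRing A]

/-- The homology of `M ⊗ P₂ → M ⊗ P₁ → M ⊗ P₀`, for `P₂ → P₁ → P₀` exact, is the kernel of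
`M ⊗ K → M ⊗ P₀` with `K` the image of `P₁` in `P₀`. -/
theorem nonempty_homology_equiv_ker_lTensor {P₂ P₁ P₀ : Type*} [AddCommGroup P₂] [Module A P₂]
    [AddCommGroup P₁] [Module A P₁] [AddCommGroup P₀] [Module A P₀] (d₂ : P₂ →ₗ[A] P₁)
    (d₁ : P₁ →ₗ[A] P₀) (hd : Function.Exact d₂ d₁) (M : Type*) [AddCommGroup M] [Module A M]
    (R : Submodule A (LinearMap.ker (d₁.lTensor M)))
    (hR : ∀ x, x ∈ R ↔ x.1 ∈ LinearMap.range (d₂.lTensor M)) :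
    Nonempty ((LinearMap.ker (d₁.lTensor M) ⧸ R) ≃ₗ[A]
      LinearMap.ker ((LinearMap.range d₁).subtype.lTensor M)) := by
  have hex : Function.Exact (d₂.lTensor M) (d₁.rangeRestrict.lTensor M) := by
    refine lTensor_exact M ?_ d₁.surjective_rangeRestrict
    intro x
    rw [← hd x, Subtype.ext_iff]
    rfl
  have hcomp : ∀ x, (LinearMap.range d₁).subtype.lTensor M (d₁.rangeRestrict.lTensor M x) =
      d₁.lTensor M x := by
    intro x
    rw [← LinearMap.lTensor_comp_apply]
    rfl
  let φ : LinearMap.ker (d₁.lTensor M) →ₗ[A]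
      LinearMap.ker ((LinearMap.range d₁).subtype.lTensor M) :=
    (d₁.rangeRestrict.lTensor M).restrict fun x hx ↦ by
      rw [LinearMap.mem_ker] at hx ⊢
      rw [hcomp, hx]
  have hφ : Function.Surjective φ := by
    rintro ⟨y, hy⟩
    obtain ⟨x, rfl⟩ := LinearMap.lTensor_surjective M d₁.surjective_rangeRestrict y
    refine ⟨⟨x, ?_⟩, rfl⟩
    rw [LinearMap.mem_ker] at hy ⊢
    rw [← hcomp, hy]
  have hk : LinearMap.ker φ = R := by
    ext x
    rw [hR, LinearMap.mem_ker, Subtype.ext_iff]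
    exact hex x.1
  exact ⟨(Submodule.quotEquivOfEq _ _ hk.symm).trans (φ.quotKerEquivOfSurjective hφ)⟩

theorem length_le_of_exact {X Y Z : Type*} [AddCommGroup X] [Module A X] [AddCommGroup Y]
    [Module A Y] [AddCommGroup Z] [Module A Z] (f : X →ₗ[A] Y) (g : Y →ₗ[A] Z)
    (h : Function.Exact f g) : Module.length A Y ≤ Module.length A X + Module.length A Z := by
  rw [Module.length_eq_add_of_exact (LinearMap.range f).subtype g.rangeRestrict
    (Submodule.injective_subtype _) g.surjective_rangeRestrict (by
      intro y
      rw [Subtype.ext_iff]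
      refine (h y).trans ?_
      simp)]
  exact add_le_add (Module.length_le_of_surjective _ f.surjective_rangeRestrict)
    (Module.length_le_of_injective _ (Submodule.injective_subtype _))

variable {K P : Type*} [AddCommGroup K] [Module A K] [AddCommGroup P] [Module A P]
  (ι : K →ₗ[A] P) {X Y Z : Type*} [AddCommGroup X] [Module A X] [AddCommGroup Y]
  [Module A Y] [AddCommGroup Z] [Module A Z]

theorem rTensor_comp_lTensor_comm (f : X →ₗ[A] Y) :
    f.rTensor P ∘ₗ ι.lTensor X = ι.lTensor Y ∘ₗ f.rTensor K := by
  rw [LinearMap.lTensor_comp_rTensor, LinearMap.rTensor_comp_lTensor]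

/-- The map induced by `f` on the kernels of `X ⊗ K → X ⊗ P` and `Y ⊗ K → Y ⊗ P`. When `P` is flat,
this is the map between the modules `Tor₁(-, P / K)`. -/
noncomputable def kerLTensorMap (f : X →ₗ[A] Y) :
    LinearMap.ker (ι.lTensor X) →ₗ[A] LinearMap.ker (ι.lTensor Y) :=
  (f.rTensor K).restrict fun x hx ↦ by
    rw [LinearMap.mem_ker] at hx ⊢
    rw [← LinearMap.comp_apply, ← rTensor_comp_lTensor_comm, LinearMap.comp_apply, hx, map_zero]

theorem exact_kerLTensorMap [Module.Flat A P] (f : X →ₗ[A] Y) (g : Y →ₗ[A] Z)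
    (hf : Function.Injective f) (hfg : Function.Exact f g) (hg : Function.Surjective g) :
    Function.Exact (kerLTensorMap ι f) (kerLTensorMap ι g) := by
  rintro ⟨y, hy⟩
  have hex := rTensor_exact K hfg hg
  constructor
  · intro h
    obtain ⟨x, rfl⟩ := (hex y).1 (congrArg Subtype.val h)
    refine ⟨⟨x, ?_⟩, rfl⟩
    rw [LinearMap.mem_ker, ← LinearMap.comp_apply, ← rTensor_comp_lTensor_comm] at hy
    exact Module.Flat.rTensor_preserves_injective_linearMap f hf (hy.trans (map_zero _).symm)
  · rintro ⟨x, hx⟩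
    refine Subtype.ext ((hex y).2 ⟨x.1, congrArg Subtype.val hx⟩)

theorem length_kerLTensor_le_add [Module.Flat A P] (f : X →ₗ[A] Y) (g : Y →ₗ[A] Z)
    (hf : Function.Injective f) (hfg : Function.Exact f g) (hg : Function.Surjective g) :
    Module.length A (LinearMap.ker (ι.lTensor Y)) ≤
      Module.length A (LinearMap.ker (ι.lTensor X)) +
        Module.length A (LinearMap.ker (ι.lTensor Z)) :=
  length_le_of_exact _ _ (exact_kerLTensorMap ι f g hf hfg hg)

theorem kerLTensorMap_comp_apply (f : X →ₗ[A] Y) (g : Y →ₗ[A] Z) (x) :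
    kerLTensorMap ι g (kerLTensorMap ι f x) = kerLTensorMap ι (g ∘ₗ f) x :=
  Subtype.ext (LinearMap.rTensor_comp_apply K g f x.1).symm

theorem kerLTensorMap_id (x : LinearMap.ker (ι.lTensor X)) :
    kerLTensorMap ι LinearMap.id x = x :=
  Subtype.ext (LinearMap.rTensor_id_apply K X x.1)

theorem length_kerLTensor_prod [Module.Flat A P] :
    Module.length A (LinearMap.ker (ι.lTensor (X × Z))) =
      Module.length A (LinearMap.ker (ι.lTensor X)) +
        Module.length A (LinearMap.ker (ι.lTensor Z)) := by
  refine Module.length_eq_add_of_exact (kerLTensorMap ι (LinearMap.inl A X Z))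
    (kerLTensorMap ι (LinearMap.snd A X Z)) ?_ ?_ (exact_kerLTensorMap ι _ _
      LinearMap.inl_injective Function.Exact.inl_snd LinearMap.snd_surjective)
  · refine Function.LeftInverse.injective (g := kerLTensorMap ι (LinearMap.fst A X Z)) fun x ↦ ?_
    rw [kerLTensorMap_comp_apply, LinearMap.fst_comp_inl, kerLTensorMap_id]
  · refine Function.RightInverse.surjective (g := kerLTensorMap ι (LinearMap.inr A X Z)) fun x ↦ ?_
    rw [kerLTensorMap_comp_apply, LinearMap.snd_comp_inr, kerLTensorMap_id]

/-- The snake lemma: `Tor₁(L / S, P / K)` is the kernel of `S ⊗ (P / K) → L ⊗ (P / K)`, for flat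
modules `L` and `P`. -/
theorem nonempty_kerLTensor_equiv_ker_rTensor {W : Type*} [AddCommGroup W] [Module A W]
    [Module.Flat A P] [Module.Flat A Y] (hι : Function.Injective ι) (π : P →ₗ[A] W)
    (hπ : Function.Exact ι π) (hπ' : Function.Surjective π) (f : X →ₗ[A] Y) (g : Y →ₗ[A] Z)
    (hf : Function.Injective f) (hfg : Function.Exact f g) (hg : Function.Surjective g) :
    Nonempty (LinearMap.ker (ι.lTensor Z) ≃ₗ[A] LinearMap.ker (f.rTensor W)) := by
  have hY : Function.Injective (ι.lTensor Y) :=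
    Module.Flat.lTensor_preserves_injective_linearMap ι hι
  have hP : Function.Injective (f.rTensor P) :=
    Module.Flat.rTensor_preserves_injective_linearMap f hf
  have h0 : Function.Exact (0 : PUnit →ₗ[A] Y ⊗[A] K) (ι.lTensor Y) := by
    rw [LinearMap.exact_zero_iff_injective]
    exact hY
  have hK3 : Function.Exact (LinearMap.ker (ι.lTensor Z)).subtype (ι.lTensor Z) :=
    LinearMap.exact_subtype_ker_map _
  have e1 := SnakeLemma.exact_δ'_right (ι.lTensor X) (ι.lTensor Y) (ι.lTensor Z) (f.rTensor K)
    (g.rTensor K) (rTensor_exact K hfg hg) (f.rTensor P) (g.rTensor P) (rTensor_exact P hfg hg)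
    (rTensor_comp_lTensor_comm ι _) (rTensor_comp_lTensor_comm ι _)
    (0 : PUnit →ₗ[A] Y ⊗[A] K) h0 (LinearMap.ker (ι.lTensor Z)).subtype hK3
    (π.lTensor X) (lTensor_exact X hπ hπ') (LinearMap.rTensor_surjective K hg) hP 0 (by simp)
    (Submodule.injective_subtype _)
  have e2 := SnakeLemma.exact_δ'_left (ι.lTensor X) (ι.lTensor Y) (ι.lTensor Z) (f.rTensor K)
    (g.rTensor K) (rTensor_exact K hfg hg) (f.rTensor P) (g.rTensor P) (rTensor_exact P hfg hg)
    (rTensor_comp_lTensor_comm ι _) (rTensor_comp_lTensor_comm ι _)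
    (LinearMap.ker (ι.lTensor Z)).subtype hK3
    (π.lTensor X) (lTensor_exact X hπ hπ') (π.lTensor Y) (lTensor_exact Y hπ hπ')
    (LinearMap.rTensor_surjective K hg) hP
    (f.rTensor W) (rTensor_comp_lTensor_comm π f)
    (LinearMap.lTensor_surjective X hπ')
  rw [LinearMap.exact_zero_iff_injective] at e1
  exact ⟨(LinearEquiv.ofInjective _ e1).trans (LinearEquiv.ofEq _ _ e2.linearMap_ker_eq.symm)⟩

/-- For `S ⊆ L`, the kernel of `S ⊗ A / J → L ⊗ A / J` is `(S ∩ J L) / J S`. -/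
theorem length_ker_rTensor_quotient {L : Type*} [AddCommGroup L] [Module A L] (S : Submodule A L)
    (J : Ideal A) :
    Module.length A (LinearMap.ker (S.subtype.rTensor (A ⧸ J))) =
      Module.length A (LinearMap.range ((J • ⊤ : Submodule A S).mkQ ∘ₗ
        ((J • ⊤ : Submodule A L).comap S.subtype).subtype)) := by
  set e := TensorProduct.tensorQuotEquivQuotSMul S J
  set e' := TensorProduct.tensorQuotEquivQuotSMul L J
  have hle : (J • ⊤ : Submodule A S) ≤ (J • ⊤ : Submodule A L).comap S.subtype := by
    rw [← Submodule.map_le_iff_le_comap, Submodule.map_smul'']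
    exact Submodule.smul_mono le_rfl le_top
  let m := Submodule.mapQ _ _ S.subtype hle
  have hm : ∀ x, m (e x) = e' (S.subtype.rTensor (A ⧸ J) x) := by
    intro x
    induction x with
    | zero => simp
    | add x y hx hy => simp [hx, hy]
    | tmul x y =>
      obtain ⟨r, rfl⟩ := Ideal.Quotient.mk_surjective y
      simp [m, e, e']
  have hk : (LinearMap.ker (S.subtype.rTensor (A ⧸ J))).map e.toLinearMap =
      LinearMap.range ((J • ⊤ : Submodule A S).mkQ ∘ₗ
        ((J • ⊤ : Submodule A L).comap S.subtype).subtype) := by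
    have h1 : (LinearMap.ker (S.subtype.rTensor (A ⧸ J))).map e.toLinearMap = LinearMap.ker m := by
      ext y
      obtain ⟨x, rfl⟩ := e.surjective y
      rw [LinearMap.mem_ker, hm, LinearEquiv.map_eq_zero_iff]
      constructor
      · rintro ⟨z, hz, h⟩
        rw [← e.injective h]
        exact hz
      · exact fun h ↦ ⟨x, h, rfl⟩
    rw [h1, LinearMap.range_comp, Submodule.range_subtype, Submodule.ker_mapQ]
  rw [← hk]
  exact (e.submoduleMap _).length_eq

end LinearAlgebra

section Tor

variable {A : Type u} [CommRing A]

/-- `Tor₁(M, Z)` is the kernel of `M ⊗ K → M ⊗ P` for a presentation `0 → K → P → Z → 0` with `P`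
flat. The presentation is the one given by the chosen projective resolution of `Z`. -/
theorem exists_tor_equiv (Z : ModuleCat.{u} A) :
    ∃ (P : ModuleCat.{u} A) (K : Submodule A P) (π : P →ₗ[A] Z), Module.Flat A P ∧
      Function.Exact K.subtype π ∧ Function.Surjective π ∧
      ∀ M : ModuleCat.{u} A, Nonempty (((Tor (ModuleCat.{u} A) 1).obj M).obj Z ≃ₗ[A]
        LinearMap.ker (K.subtype.lTensor M)) := by
  let R := projectiveResolution Z
  let C := R.complex
  let π : C.X 0 ⟶ Z := R.π.f 0
  have hex₀ : Function.Exact (C.d 1 0).hom π.hom :=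
    (ShortComplex.ShortExact.moduleCat_exact_iff_function_exact _).1 R.exact₀
  have hex₁ : Function.Exact (C.d 2 1).hom (C.d 1 0).hom :=
    (ShortComplex.ShortExact.moduleCat_exact_iff_function_exact _).1 (R.exact_succ 0)
  have hproj : Projective (C.X 0) := R.projective 0
  have hflat : Module.Projective A (C.X 0) := (IsProjective.iff_projective (C.X 0)).2 hproj
  have hepi : Epi π := inferInstanceAs (Epi (R.π.f 0))
  refine ⟨C.X 0, LinearMap.range (C.d 1 0).hom, π.hom, inferInstance, ?_,
    (ModuleCat.epi_iff_surjective π).1 hepi, fun M ↦ ?_⟩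
  · rw [LinearMap.exact_iff, Submodule.range_subtype, hex₀.linearMap_ker_eq]
  let F := (MonoidalCategory.tensoringLeft (ModuleCat.{u} A)).obj M
  let FC := (F.mapHomologicalComplex (ComplexShape.down ℕ)).obj C
  let i₁ : ((Tor (ModuleCat.{u} A) 1).obj M).obj Z ≅ FC.homology 1 := R.isoLeftDerivedObj F 1
  let i₂ : FC.homology 1 ≅ (FC.sc' 2 1 0).homology :=
    FC.homologyIsoSc' 2 1 0 (by simp) (by simp)
  let i₃ := (FC.sc' 2 1 0).moduleCatHomologyIso
  obtain ⟨e⟩ := nonempty_homology_equiv_ker_lTensor (C.d 2 1).hom (C.d 1 0).hom hex₁ M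
    (LinearMap.range (FC.sc' 2 1 0).moduleCatToCycles) (by
      rintro ⟨x, hx⟩
      constructor
      · rintro ⟨y, hy⟩
        exact ⟨y, congrArg Subtype.val hy⟩
      · rintro ⟨y, hy⟩
        exact ⟨y, Subtype.ext hy⟩)
  exact ⟨(i₁ ≪≫ i₂ ≪≫ i₃).toLinearEquiv.trans e⟩

/-- The length of `Tor₁(M, Z)`. -/
noncomputable def torLength (M Z : ModuleCat.{u} A) : ℕ∞ :=
  Module.length A (((Tor (ModuleCat.{u} A) 1).obj M).obj Z)

theorem torLength_le_add (Z : ModuleCat.{u} A) {X E Y : ModuleCat.{u} A} {i : X ⟶ E} {q : E ⟶ Y}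
    {w : i ≫ q = 0} (hS : (ShortComplex.mk i q w).ShortExact) :
    torLength E Z ≤ torLength X Z + torLength Y Z := by
  obtain ⟨P, K, π, _, -, -, h⟩ := exists_tor_equiv Z
  have hi : Function.Injective i.hom := hS.moduleCat_injective_f
  have hq : Function.Surjective q.hom := hS.moduleCat_surjective_g
  have hex : Function.Exact i.hom q.hom :=
    (ShortComplex.ShortExact.moduleCat_exact_iff_function_exact _).1 hS.exact
  simp only [torLength, (h _).some.length_eq]
  exact length_kerLTensor_le_add K.subtype i.hom q.hom hi hex hq

theorem torLength_congr (Z : ModuleCat.{u} A) {M M' : ModuleCat.{u} A} (e : M ≅ M') :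
    torLength M Z = torLength M' Z :=
  (((Tor (ModuleCat.{u} A) 1).mapIso e).app Z).toLinearEquiv.length_eq

theorem torLength_biprod (Z M N : ModuleCat.{u} A) :
    torLength (M ⊞ N) Z = torLength M Z + torLength N Z := by
  rw [torLength_congr Z (ModuleCat.biprodIsoProd M N)]
  obtain ⟨P, K, π, _, -, -, h⟩ := exists_tor_equiv Z
  simp only [torLength, (h _).some.length_eq]
  exact length_kerLTensor_prod K.subtype

theorem torLength_quotient {L : Type u} [AddCommGroup L] [Module A L] [Module.Flat A L]
    {M : ModuleCat.{u} A} (g : L →ₗ[A] M) (hg : Function.Surjective g) (J : Ideal A) :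
    torLength M (ModuleCat.of A (A ⧸ J)) =
      Module.length A (LinearMap.range ((J • ⊤ : Submodule A (LinearMap.ker g)).mkQ ∘ₗ
        ((J • ⊤ : Submodule A L).comap (LinearMap.ker g).subtype).subtype)) := by
  obtain ⟨P, K, π, _, hπ, hπ', h⟩ := exists_tor_equiv (ModuleCat.of A (A ⧸ J))
  obtain ⟨e⟩ := nonempty_kerLTensor_equiv_ker_rTensor K.subtype K.injective_subtype π hπ hπ'
    (LinearMap.ker g).subtype g (Submodule.injective_subtype _)
    (LinearMap.exact_subtype_ker_map g) hg
  exact ((h M).some.length_eq.trans e.length_eq).trans (length_ker_rTensor_quotient _ J)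

end Tor

end TSplit

/-! ### Lengths of Tor along admissible filtrations -/

namespace TSplit

section Filtration

variable {A : Type*} [CommRing A] {I : Ideal A} {F : ℕ → Ideal A}

/-- The filtration `F n • X` of a module `X` induced by an `I`-admissible filtration of ideals. -/
def IsAdmissible.filtration (hF : IsAdmissible I F) (X : Type*) [AddCommGroup X] [Module A X] :
    I.Filtration X where
  N n := F n • ⊤
  mono n := Submodule.smul_mono_left (hF.antitone n.le_succ)
  smul_le n := by
    rw [← mul_smul]
    refine Submodule.smul_mono_left ?_
    rw [add_comm]
    exact (Ideal.mul_mono_left (by simpa using hF.pow_le 1)).trans (hF.mul_le 1 n)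

theorem IsAdmissible.filtration_stable (hF : IsAdmissible I F) (X : Type*) [AddCommGroup X]
    [Module A X] : (hF.filtration X).Stable := by
  obtain ⟨n₀, h⟩ := hF.stable
  refine ⟨n₀, fun n hn ↦ ?_⟩
  change I • (F n • ⊤ : Submodule A X) = F (n + 1) • ⊤
  rw [h n hn, mul_smul]

/-- The filtration induced on a submodule. -/
def filtrationComap {X : Type*} [AddCommGroup X] [Module A X] (G : I.Filtration X)
    (S : Submodule A X) : I.Filtration S where
  N n := (G.N n).comap S.subtype
  mono n := Submodule.comap_mono (G.mono n)
  smul_le n := Submodule.smul_le.2 fun _ hr _ hx ↦ G.smul_le n (Submodule.smul_mem_smul hr hx)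

/-- The Artin–Rees lemma. -/
theorem filtrationComap_stable [IsNoetherianRing A] {X : Type*} [AddCommGroup X] [Module A X]
    [Module.Finite A X] {G : I.Filtration X} (hG : G.Stable) (S : Submodule A X) :
    (filtrationComap G S).Stable := by
  obtain ⟨n₀, h⟩ := hG.inter_right (F' := I.trivialFiltration S)
  refine ⟨n₀, fun n hn ↦ Submodule.map_injective_of_injective S.injective_subtype ?_⟩
  have e : ∀ n, ((filtrationComap G S).N n).map S.subtype = (G ⊓ I.trivialFiltration S).N n :=
    fun n ↦ (Submodule.map_comap_subtype S (G.N n)).trans (inf_comm _ _)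
  rw [Submodule.map_smul'', e, e]
  exact h n hn

end Filtration

theorem torSeq_eq {A : Type u} [CommRing A] (d : ℕ) (F : ℕ → Ideal A) (M : ModuleCat.{u} A) (n : ℕ) :
    torSeq d F M n = ((d - 1).factorial : ℝ) / (n : ℝ) ^ (d - 1) *
      ((torLength M (ModuleCat.of A (A ⧸ F (n + 1)))).toNat : ℝ) := rfl

section TorLength

variable {A : Type u} [CommRing A] [IsLocalRing A] [IsNoetherianRing A] {I : Ideal A}
  {F : ℕ → Ideal A}

theorem IsAdmissible.length_quotient_ne_top (hF : IsAdmissible I F)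
    (hI : I.radical = maximalIdeal A) {X : Type*} [AddCommGroup X] [Module A X]
    [Module.Finite A X] (n : ℕ) : Module.length A (X ⧸ (F n • ⊤ : Submodule A X)) ≠ ⊤ :=
  length_quotient_ne_top_of_le (Submodule.smul_mono_left (hF.pow_le n))
    (length_quotient_pow_smul_ne_top hI n)

theorem IsAdmissible.torLength_ne_top (hF : IsAdmissible I F)
    (hI : I.radical = maximalIdeal A) (M : ModuleCat.{u} A) [Module.Finite A M] (n : ℕ) :
    torLength M (ModuleCat.of A (A ⧸ F n)) ≠ ⊤ := by
  obtain ⟨m, g, hg⟩ := Module.Finite.exists_fin' A M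
  rw [torLength_quotient g hg]
  exact ne_top_of_le_ne_top (hF.length_quotient_ne_top hI n)
    (Module.length_le_of_injective _ (Submodule.injective_subtype _))

open Asymptotics in
/-- The function `n ↦ ℓ(Tor₁(M, A / F n))` is of polynomial type of degree at most `d - 1`. For a
presentation `0 → S → L → M → 0` with `L` free of finite rank it is `ℓ((S ∩ F n L) / F n S)`,
which is the Hilbert function of the quotient of two stable filtrations. By Artin–Rees it is bounded
by a difference `p (n + c) - p n`, with `p` the Hilbert–Samuel function of `S`. -/
theorem IsAdmissible.eventuallyPoly_torLength (hF : IsAdmissible I F)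
    (hI : I.radical = maximalIdeal A) {e : ℕ} (hdim : ringKrullDim A = (e + 1 : ℕ))
    (M : ModuleCat.{u} A) [Module.Finite A M] :
    EventuallyPoly (e + 1)
      (fun n ↦ ((torLength M (ModuleCat.of A (A ⧸ F n))).toNat : ℤ)) := by
  obtain ⟨m, g, hg⟩ := Module.Finite.exists_fin' A M
  let S := LinearMap.ker g
  let K : I.Filtration S := hF.filtration S
  let L : I.Filtration S := filtrationComap (hF.filtration (Fin m → A)) S
  have hL : L.Stable := filtrationComap_stable (hF.filtration_stable _) S
  have hKL : K ≤ L := fun n ↦ by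
    change (F n • ⊤ : Submodule A S) ≤ (F n • ⊤ : Submodule A (Fin m → A)).comap S.subtype
    rw [← Submodule.map_le_iff_le_comap, Submodule.map_smul'']
    exact Submodule.smul_mono le_rfl le_top
  have hfin : ∀ n, Module.length A (S ⧸ K.N n) ≠ ⊤ := hF.length_quotient_ne_top hI
  have hlen : ∀ n, ((torLength M (ModuleCat.of A (A ⧸ F n))).toNat : ℤ) =
      colength (K.N n) - colength (L.N n) := by
    intro n
    rw [torLength_quotient g hg, colength_eq_add (hKL n) (hfin n)]
    push_cast
    rw [add_sub_cancel_right]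
    rfl
  simp only [hlen]
  obtain ⟨t, ht⟩ := (inferInstance : IsNoetherianRing A).noetherian I
  have hpoly := eventuallyPoly_colength_sub t ⊥ (by rw [bot_sup_eq]; exact ht.symm) K L hKL hL
    (by simp) hfin
  obtain ⟨n₀, hn₀⟩ := hL.exists_pow_smul_eq
  refine EventuallyPoly.of_shift n₀ ((hpoly.shift n₀).of_isBigO ?_)
  have hp := ((eventuallyPoly_hilbertSamuel (M := S) hdim hI).shift_sub n₀).isBigO
  refine (IsBigO.of_bound 1 (Eventually.of_forall fun n ↦ ?_)).trans hp
  have hpow := length_quotient_pow_smul_ne_top (M := S) hI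
  have h1 : colength (K.N (n + n₀)) ≤ colength (I ^ (n + n₀) • ⊤ : Submodule A S) :=
    colength_anti (Submodule.smul_mono_left (hF.pow_le _)) (hpow _)
  have h2 : colength (I ^ n • ⊤ : Submodule A S) ≤ colength (L.N (n + n₀)) := by
    refine colength_anti ?_ (length_quotient_ne_top_of_le (hKL _) (hfin _))
    rw [add_comm, hn₀]
    exact Submodule.smul_mono le_rfl le_top
  have h3 : colength (L.N (n + n₀)) ≤ colength (K.N (n + n₀)) := colength_anti (hKL _) (hfin _)
  rw [one_mul, Real.norm_eq_abs, Real.norm_eq_abs]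
  refine abs_le_abs_of_nonneg ?_ ?_
  · have : (0 : ℤ) ≤ colength (K.N (n + n₀)) - colength (L.N (n + n₀)) := by omega
    exact_mod_cast this
  · have : ((colength (K.N (n + n₀)) : ℤ) - colength (L.N (n + n₀))) ≤
      (colength (I ^ (n + n₀) • ⊤ : Submodule A S) : ℤ) -
        colength (I ^ n • ⊤ : Submodule A S) := by omega
    exact_mod_cast this

variable {d : ℕ} (hd : 1 ≤ d) (hdim : ringKrullDim A = d) (hF : IsAdmissible I F)
  (hI : I.radical = maximalIdeal A)

include hd hdim hF hI

theorem exists_tendsto_torSeq (M : ModuleCat.{u} A) [Module.Finite A M] :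
    ∃ m : ℕ, Tendsto (torSeq d F M) atTop (𝓝 (m : ℝ)) := by
  obtain ⟨e, rfl⟩ := Nat.exists_eq_add_of_le' hd
  obtain ⟨c, -, hc⟩ := ((hF.eventuallyPoly_torLength hI hdim M).shift 1).exists_tendsto
  have hc0 : (0 : ℝ) ≤ c := ge_of_tendsto' hc fun n ↦ by positivity
  lift c to ℕ using by exact_mod_cast hc0
  exact ⟨c, hc.congr fun n ↦ by simp [torSeq_eq]⟩

theorem tendsto_torSeq (M : ModuleCat.{u} A) [Module.Finite A M] :
    Tendsto (torSeq d F M) atTop (𝓝 (eT d F M)) := by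
  obtain ⟨m, hm⟩ := exists_tendsto_torSeq hd hdim hF hI M
  exact tendsto_nhds_limUnder ⟨_, hm⟩

theorem exists_eT_eq (M : ModuleCat.{u} A) [Module.Finite A M] : ∃ m : ℕ, eT d F M = m := by
  obtain ⟨m, hm⟩ := exists_tendsto_torSeq hd hdim hF hI M
  exact ⟨m, hm.limUnder_eq⟩

theorem eT_le_add {X E Y : ModuleCat.{u} A} [Module.Finite A X] [Module.Finite A E]
    [Module.Finite A Y] {i : X ⟶ E} {q : E ⟶ Y} {w : i ≫ q = 0}
    (hS : (ShortComplex.mk i q w).ShortExact) : eT d F E ≤ eT d F X + eT d F Y := by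
  refine le_of_tendsto_of_tendsto' (tendsto_torSeq hd hdim hF hI E)
    ((tendsto_torSeq hd hdim hF hI X).add (tendsto_torSeq hd hdim hF hI Y)) fun n ↦ ?_
  rw [torSeq_eq, torSeq_eq, torSeq_eq, ← mul_add]
  refine mul_le_mul_of_nonneg_left ?_ (by positivity)
  have h1 := hF.torLength_ne_top hI X (n + 1)
  have h3 := hF.torLength_ne_top hI Y (n + 1)
  have := ENat.toNat_le_toNat (torLength_le_add (ModuleCat.of A (A ⧸ F (n + 1))) hS) (by simp [h1, h3])
  rw [ENat.toNat_add h1 h3] at this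
  exact_mod_cast this

theorem eT_biprod (M N : ModuleCat.{u} A) [Module.Finite A M] [Module.Finite A N] :
    eT d F (M ⊞ N) = eT d F M + eT d F N := by
  refine Tendsto.limUnder_eq (((tendsto_torSeq hd hdim hF hI M).add
    (tendsto_torSeq hd hdim hF hI N)).congr fun n ↦ ?_)
  rw [torSeq_eq, torSeq_eq, torSeq_eq, ← mul_add, torLength_biprod,
    ENat.toNat_add (hF.torLength_ne_top hI M _) (hF.torLength_ne_top hI N _)]
  push_cast
  rfl

end TorLength

end TSplit

/-! ### Pullbacks of extensions and their classes -/

namespace TSplit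

section Pullback

variable {A : Type u} [CommRing A]

theorem shortExact_pullback_snd {N X M Y : ModuleCat.{u} A} {i : N ⟶ X} {q : X ⟶ M}
    {w : i ≫ q = 0} (h : (ShortComplex.mk i q w).ShortExact) (g : Y ⟶ M) :
    (ShortComplex.mk (pullback.lift i 0 (by rw [w, zero_comp]) : N ⟶ pullback q g)
      (pullback.snd q g) (pullback.lift_snd _ _ _)).ShortExact := by
  have hi : Mono i := h.mono_f
  have hq : Epi q := h.epi_g
  have hm : Mono (pullback.lift i 0 (by rw [w, zero_comp]) : N ⟶ pullback q g) := by
    have : Mono (pullback.lift i 0 (by rw [w, zero_comp]) ≫ pullback.fst q g) := by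
      rw [pullback.lift_fst]
      exact hi
    exact mono_of_mono _ (pullback.fst q g)
  refine { exact := ?_, mono_f := hm, epi_g := inferInstanceAs (Epi (pullback.snd q g)) }
  apply ShortComplex.exact_of_f_is_kernel
  refine KernelFork.IsLimit.ofι' _ _ fun {B} k hk ↦ ?_
  have hk' : (k ≫ pullback.fst q g) ≫ q = 0 := by
    rw [Category.assoc, pullback.condition, ← Category.assoc]
    exact (congrArg (· ≫ g) hk).trans zero_comp
  refine ⟨h.exact.lift (k ≫ pullback.fst q g) hk', ?_⟩
  apply pullback.hom_ext
  · rw [Category.assoc, pullback.lift_fst]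
    exact h.exact.lift_f _ _
  · rw [Category.assoc, pullback.lift_snd, comp_zero]
    exact hk.symm

/-- The class of the pullback of an extension along `g` is the Yoneda product with `g`. -/
theorem isMiddle_pullback {N X M Y : ModuleCat.{u} A} {i : N ⟶ X} {q : X ⟶ M}
    {w : i ≫ q = 0} (h : (ShortComplex.mk i q w).ShortExact) (g : Y ⟶ M) :
    IsMiddle ((Ext.mk₀ g).comp h.extClass (zero_add 1)) (pullback q g) := by
  refine ⟨_, _, _, shortExact_pullback_snd h g, ?_⟩
  have := ShortComplex.ShortExact.extClass_naturality (shortExact_pullback_snd h g) h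
    { τ₁ := 𝟙 N, τ₂ := pullback.fst q g, τ₃ := g
      comm₁₂ := by
        change 𝟙 N ≫ i = _ ≫ pullback.fst q g
        rw [pullback.lift_fst, Category.id_comp]
      comm₂₃ := pullback.condition }
  exact (Ext.comp_mk₀_id _).symm.trans this

theorem shortExact_pullback_biprod {X M Y : ModuleCat.{u} A} (q : X ⟶ M) (g : Y ⟶ M) [Epi q] :
    (ShortComplex.mk (biprod.lift (pullback.fst q g) (pullback.snd q g)) (biprod.desc q (-g))
      (by simp [pullback.condition])).ShortExact where
  exact := (IsPullback.of_hasPullback q g).exact_shortComplex'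
  mono_f := (IsPullback.of_hasPullback q g).mono_shortComplex'_f
  epi_g := by
    have : Epi (biprod.inl ≫ biprod.desc q (-g)) := by
      rw [biprod.inl_desc]
      infer_instance
    exact epi_of_epi biprod.inl (biprod.desc q (-g))

theorem finite_of_shortExact [IsNoetherianRing A] {X E Y : ModuleCat.{u} A}
    [Module.Finite A X] [Module.Finite A Y] {i : X ⟶ E} {q : E ⟶ Y} {w : i ≫ q = 0}
    (hS : (ShortComplex.mk i q w).ShortExact) : Module.Finite A E := by
  have : IsNoetherian A E := isNoetherian_of_range_eq_ker i.hom q.hom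
    hS.exact.moduleCat_range_eq_ker
  infer_instance

theorem IsMiddle.finite [IsNoetherianRing A] {M N E : ModuleCat.{u} A} {α : Ext M N 1}
    (h : IsMiddle α E) [Module.Finite A M] [Module.Finite A N] : Module.Finite A E := by
  obtain ⟨i, q, w, h, -⟩ := h
  exact finite_of_shortExact h

end Pullback

section Classes

variable {A : Type u} [CommRing A] [IsLocalRing A] [IsNoetherianRing A] {I : Ideal A}
  {F : ℕ → Ideal A} {d : ℕ} (hd : 1 ≤ d) (hdim : ringKrullDim A = d) (hF : IsAdmissible I F)
  (hI : I.radical = maximalIdeal A)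
  {M N : ModuleCat.{u} A} [Module.Finite A M] [Module.Finite A N]

include hd hdim hF hI

theorem eTClass_nonneg (α : Ext M N 1) : 0 ≤ eTClass d F α := by
  have hfin := (isMiddle_middle α).finite
  obtain ⟨i, q, w, h, -⟩ := isMiddle_middle α
  have : eT d F (middle α) ≤ eT d F N + eT d F M := eT_le_add hd hdim hF hI h
  rw [eTClass]
  linarith

theorem exists_eTClass_eq (α : Ext M N 1) : ∃ m : ℕ, eTClass d F α = m := by
  have hfin := (isMiddle_middle α).finite
  obtain ⟨a, ha⟩ := exists_eT_eq hd hdim hF hI M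
  obtain ⟨b, hb⟩ := exists_eT_eq hd hdim hF hI N
  obtain ⟨c, hc⟩ := exists_eT_eq hd hdim hF hI (middle α)
  have h := eTClass_nonneg hd hdim hF hI α
  rw [eTClass, ha, hb, hc] at h ⊢
  have h' : c ≤ a + b := by
    have : (c : ℝ) ≤ a + b := by linarith
    exact_mod_cast this
  exact ⟨a + b - c, by push_cast [h']; ring⟩

/-- For an extension `X` of `M` by `N` and `g : Y → M`, the pullback `P = X ×_M Y` lies in an exact
sequence `0 → P → X ⊕ Y → M → 0`. -/
theorem eT_add_le_of_isMiddle_comp {α : Ext M N 1} {X : ModuleCat.{u} A} (hX : IsMiddle α X)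
    {Y : ModuleCat.{u} A} [Module.Finite A Y] (g : Y ⟶ M) {P : ModuleCat.{u} A}
    (hP : IsMiddle ((Ext.mk₀ g).comp α (zero_add 1)) P) :
    eT d F X + eT d F Y ≤ eT d F P + eT d F M := by
  have hXfin := hX.finite
  obtain ⟨i, q, w, h, rfl⟩ := hX
  have hQ := isMiddle_pullback h g
  obtain ⟨e⟩ := hP.nonempty_iso hQ
  rw [eT_congr d F e]
  have hq : Epi q := h.epi_g
  have h1 := hQ.finite
  have h2 : Module.Finite A (X ⊞ Y : ModuleCat.{u} A) :=
    Module.Finite.equiv (ModuleCat.biprodIsoProd X Y).toLinearEquiv.symm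
  rw [← eT_biprod hd hdim hF hI X Y]
  exact eT_le_add hd hdim hF hI (shortExact_pullback_biprod q g)

/-- For an extension `X` of `M` by `N` and an epimorphism `g : Y → M` with kernel `N'`, the pullback
`P = X ×_M Y` lies in an exact sequence `0 → N' → P → X → 0`. -/
theorem eT_le_of_isMiddle_comp {α : Ext M N 1} {X : ModuleCat.{u} A} (hX : IsMiddle α X)
    {N' Y : ModuleCat.{u} A} [Module.Finite A N'] {j : N' ⟶ Y} {g : Y ⟶ M} {w' : j ≫ g = 0}
    (hg : (ShortComplex.mk j g w').ShortExact) {P : ModuleCat.{u} A}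
    (hP : IsMiddle ((Ext.mk₀ g).comp α (zero_add 1)) P) :
    eT d F P ≤ eT d F N' + eT d F X := by
  have hXfin := hX.finite
  obtain ⟨i, q, w, h, rfl⟩ := hX
  obtain ⟨e⟩ := hP.nonempty_iso (isMiddle_pullback h g)
  rw [eT_congr d F (e ≪≫ pullbackSymmetry q g)]
  have hs := shortExact_pullback_snd hg q
  have h2 := finite_of_shortExact hs
  exact eT_le_add hd hdim hF hI hs

/-- With `X`, `Y` and `E` middle terms of `α`, `β` and `α + β`, the pullbacks of `Y` and of `E` along
`X → M` are the same extension `P` of `X` by `N`, because the pullback of `α` splits. Hence `P` is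
the kernel of a surjection `Y ⊕ X → M` as well as an extension of `E` by `N`. -/
theorem eTClass_add_le (α β : Ext M N 1) :
    eTClass d F (α + β) ≤ eTClass d F α + eTClass d F β := by
  have hX := isMiddle_middle α
  have hXfin := hX.finite
  obtain ⟨i, q, w, h, hα⟩ := hX
  obtain ⟨P, hP⟩ := exists_isMiddle ((Ext.mk₀ q).comp β (zero_add 1))
  have h1 := eT_add_le_of_isMiddle_comp hd hdim hF hI (isMiddle_middle β) q hP
  have hcomp : (Ext.mk₀ q).comp (α + β) (zero_add 1) = (Ext.mk₀ q).comp β (zero_add 1) := by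
    have h0 : (Ext.mk₀ q).comp α (zero_add 1) = 0 := by
      exact (congrArg (fun x ↦ (Ext.mk₀ q).comp x (zero_add 1)) hα).symm.trans h.comp_extClass
    rw [Ext.comp_add, h0, zero_add]
  have h2 := eT_le_of_isMiddle_comp hd hdim hF hI (isMiddle_middle (α + β)) h (hcomp ▸ hP)
  simp only [eTClass]
  linarith

theorem eTClass_smul_le (a : A) (α : Ext M N 1) : eTClass d F (a • α) ≤ eTClass d F α := by
  have hcomp : (Ext.mk₀ (a • 𝟙 M)).comp α (zero_add 1) = a • α := by
    rw [Ext.mk₀_smul, Ext.smul_comp, Ext.mk₀_id_comp]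
  have hmid : IsMiddle ((Ext.mk₀ (a • 𝟙 M)).comp α (zero_add 1)) (middle (a • α)) := by
    rw [hcomp]
    exact isMiddle_middle _
  have := eT_add_le_of_isMiddle_comp hd hdim hF hI (isMiddle_middle α) (a • 𝟙 M) hmid
  simp only [eTClass]
  linarith

theorem eTClass_zero : eTClass d F (0 : Ext M N 1) = 0 := by
  let S := ShortComplex.mk (biprod.inl : N ⟶ N ⊞ M) biprod.snd biprod.inl_snd
  let s : S.Splitting :=
    { r := biprod.fst
      s := biprod.inr
      f_r := biprod.inl_fst
      s_g := biprod.inr_snd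
      id := biprod.total }
  have hmid : IsMiddle (0 : Ext M N 1) (N ⊞ M) := by
    refine ⟨_, _, _, s.shortExact, ?_⟩
    have h1 : (Ext.mk₀ (s.s ≫ S.g)).comp s.shortExact.extClass (zero_add 1) = 0 := by
      rw [← Ext.mk₀_comp_mk₀_assoc, ShortComplex.ShortExact.comp_extClass, Ext.comp_zero]
    rw [s.s_g] at h1
    exact (Ext.mk₀_id_comp _).symm.trans h1
  rw [eTClass_eq d F hmid, eT_biprod hd hdim hF hI]
  ring

theorem eTClass_add_of_eq_zero (α : Ext M N 1) {τ : Ext M N 1} (hτ : eTClass d F τ = 0) :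
    eTClass d F (α + τ) = eTClass d F α := by
  refine le_antisymm ?_ ?_
  · simpa [hτ] using eTClass_add_le hd hdim hF hI α τ
  · have h1 := eTClass_add_le hd hdim hF hI (α + τ) ((-1 : A) • τ)
    have h2 := eTClass_smul_le hd hdim hF hI (-1) τ
    rw [neg_one_smul, add_neg_cancel_right] at h1
    rw [neg_one_smul] at h2
    linarith

theorem eTClass_smul_of_isUnit {a : A} (ha : IsUnit a) (α : Ext M N 1) :
    eTClass d F (a • α) = eTClass d F α := by
  obtain ⟨u, rfl⟩ := ha
  refine le_antisymm (eTClass_smul_le hd hdim hF hI _ α) ?_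
  have := eTClass_smul_le hd hdim hF hI (↑u⁻¹ : A) ((u : A) • α)
  rwa [smul_smul, Units.inv_mul, one_smul] at this

theorem exists_submodule_eq_splitClasses :
    ∃ T : Submodule A (Ext M N 1), (T : Set (Ext M N 1)) = splitClasses d F M N :=
  ⟨{  carrier := splitClasses d F M N
      zero_mem' := eTClass_zero hd hdim hF hI
      add_mem' := fun {a _} ha hb ↦ (eTClass_add_of_eq_zero hd hdim hF hI a hb).trans ha
      smul_mem' := fun a α hα ↦ le_antisymm
        ((eTClass_smul_le hd hdim hF hI a α).trans_eq hα) (eTClass_nonneg hd hdim hF hI _) }, rfl⟩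

/-- `eTClass` factors through the projective space of the quotient by the split classes. -/
theorem exists_projectivization_map (k : Type v) [Field k] [Algebra k A]
    (T : Submodule A (Ext M N 1)) (hT : (T : Set (Ext M N 1)) = splitClasses d F M N) :
    ∃ e : Projectivization k (QuotientSpace k T) → {m : ℕ // m ≠ 0},
      ∀ (α : Ext M N 1) (h : toQuotient k T α ≠ 0),
        eTClass d F α = ((e (Projectivization.mk k (toQuotient k T α) h) : ℕ) : ℝ) := by
  have hmem : ∀ α, α ∈ T ↔ eTClass d F α = 0 := fun α ↦ Set.ext_iff.1 hT α
  have hzero : ∀ α, toQuotient k T α = 0 ↔ α ∈ T := fun α ↦ Submodule.Quotient.mk_eq_zero T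
  choose m hm using exists_eTClass_eq (M := M) (N := N) hd hdim hF hI
  have hsurj : ∀ x : Projectivization k (QuotientSpace k T),
      ∃ α, toQuotient k T α = x.rep := fun x ↦ Submodule.Quotient.mk_surjective T x.rep
  choose rep hrep using hsurj
  have hne : ∀ x, m (rep x) ≠ 0 := by
    intro x hx
    apply x.rep_nonzero
    rw [← hrep, hzero, hmem, hm, hx, Nat.cast_zero]
  refine ⟨fun x ↦ ⟨m (rep x), hne x⟩, fun α h ↦ ?_⟩
  set x := Projectivization.mk k (toQuotient k T α) h
  change _ = (m (rep x) : ℝ)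
  rw [← hm]
  have hx : Projectivization.mk k x.rep x.rep_nonzero = Projectivization.mk k _ h := x.mk_rep
  obtain ⟨c, hc⟩ := (Projectivization.mk_eq_mk_iff k _ _ _ _).1 hx
  rw [← hrep] at hc
  have hc' : (Submodule.Quotient.mk (algebraMap k A c • α) : Ext M N 1 ⧸ T) =
      Submodule.Quotient.mk (rep x) := hc
  have hsub := (Submodule.Quotient.eq T).1 hc'.symm
  have h1 := eTClass_add_of_eq_zero hd hdim hF hI (algebraMap k A c • α) ((hmem _).1 hsub)
  rw [add_sub_cancel] at h1
  rw [h1, eTClass_smul_of_isUnit hd hdim hF hI (c.isUnit.map (algebraMap k A))]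

end Classes

/-- The powers of the maximal ideal form an admissible filtration. -/
theorem isAdmissible_pow {A : Type*} [CommRing A] (I : Ideal A) : IsAdmissible I (I ^ ·) where
  antitone := fun _ _ h ↦ Ideal.pow_le_pow_right h
  pow_le := fun _ ↦ le_rfl
  mul_le := fun m n ↦ (pow_add I m n).ge
  stable := ⟨0, fun n _ ↦ pow_succ' I n⟩

end TSplit

theorem theorem1p8 {A : Type u} [CommRing A] [IsLocalRing A] (hA : TSplit.IsCohenMacaulay A)
    (d : ℕ) (hd : 1 ≤ d) (hdim : ringKrullDim A = d)
    (p : ℕ) (hp : 0 < p) [CharP A p]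
    (k : Type v) [Field k] [Algebra k A] (hk : Nonempty (k ≃+* ResidueField A))
    (F : ℕ → Ideal A)
    (hF : (∀ n, F n = maximalIdeal A ^ n) ∨
      (TSplit.IsAnalyticallyUnramified A ∧ TSplit.IsIntegralClosureFiltration F))
    (M N : ModuleCat.{u} A) (hM : TSplit.IsMCM A M) (hN : TSplit.IsMCM A N)
    (hne : TSplit.splitClasses d F M N ≠ Set.univ) :
    -- the limits defining the values of `e^T` exist and `e^T` is `ℕ`-valued
    ((∃ m : ℕ, Tendsto (TSplit.torSeq d F M) atTop (𝓝 (m : ℝ))) ∧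
      (∃ m : ℕ, Tendsto (TSplit.torSeq d F N) atTop (𝓝 (m : ℝ))) ∧
      ∀ α : Ext M N 1,
        (∃ m : ℕ, Tendsto (TSplit.torSeq d F (TSplit.middle α)) atTop (𝓝 (m : ℝ))) ∧
        ∃ m : ℕ, TSplit.eTClass d F α = m) ∧
    -- invariance under adding split classes and under scaling by nonzero elements of `k`
    (∀ α τ : Ext M N 1, τ ∈ TSplit.splitClasses d F M N →
      TSplit.eTClass d F (α + τ) = TSplit.eTClass d F α) ∧
    (∀ (c : k) (α : Ext M N 1), c ≠ 0 →
      TSplit.eTClass d F (algebraMap k A c • α) = TSplit.eTClass d F α) ∧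
    -- the split classes form a submodule, and `e^T` factors through the projective space of the
    -- quotient, with positive values there
    ∃ T : Submodule A (Ext M N 1), (T : Set (Ext M N 1)) = TSplit.splitClasses d F M N ∧
      ∃ e : Projectivization k (TSplit.QuotientSpace k T) → {m : ℕ // m ≠ 0},
        ∀ (α : Ext M N 1) (h : TSplit.toQuotient k T α ≠ 0),
          TSplit.eTClass d F α = ((e (Projectivization.mk k (TSplit.toQuotient k T α) h) : ℕ) : ℝ)
    := by
  have hnoeth : IsNoetherianRing A := hA.1
  have hMfin : Module.Finite A M := hM.1
  have hNfin : Module.Finite A N := hN.1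
  obtain ⟨I, hI, hF⟩ : ∃ I : Ideal A, I.radical = maximalIdeal A ∧ TSplit.IsAdmissible I F := by
    rcases hF with hF | ⟨-, I, hI, hF, -⟩
    · refine ⟨maximalIdeal A, (maximalIdeal.isMaximal A).isPrime.radical, ?_⟩
      rw [show F = (maximalIdeal A ^ ·) from funext hF]
      exact TSplit.isAdmissible_pow _
    · exact ⟨I, hI, hF⟩
  refine ⟨⟨TSplit.exists_tendsto_torSeq hd hdim hF hI M,
    TSplit.exists_tendsto_torSeq hd hdim hF hI N, fun α ↦ ⟨?_, ?_⟩⟩, ?_, ?_, ?_⟩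
  · have := (TSplit.isMiddle_middle α).finite
    exact TSplit.exists_tendsto_torSeq hd hdim hF hI _
  · exact TSplit.exists_eTClass_eq hd hdim hF hI α
  · exact fun α τ hτ ↦ TSplit.eTClass_add_of_eq_zero hd hdim hF hI α hτ
  · exact fun c α hc ↦ TSplit.eTClass_smul_of_isUnit hd hdim hF hI
      ((isUnit_iff_ne_zero.2 hc).map (algebraMap k A)) α
  · obtain ⟨T, hT⟩ := TSplit.exists_submodule_eq_splitClasses (M := M) (N := N) hd hdim hF hI
    exact ⟨T, hT, TSplit.exists_projectivization_map hd hdim hF hI k T hT⟩
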